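/- Let the elementary gates on $n$ wires be: NOT, Hadamard $H$, the rotations $R_a(\theta)=e^{-i\theta\sigma_a/2}$ with $a\in\{x,y,z\}$ and $\theta\in[0,2\pi]$ (where $\sigma_a$ are the Pauli matrices), CNOT, and controlled-$V$ with $V=\frac{1+i}{2}\begin{pmatrix}1&-i\\-i&1\end{pmatrix}$ (so $V^2=\mathrm{NOT}$), each applied to arbitrary wires (control and target distinct). An $n$-wire circuit is a finite sequence of such gates, without ancillary wires, and it implements a permutation $f$ of $\{0,1\}^n$ if the product of its gates equals, up to a global phase, the permutation matrix $P$ with $P|x\rangle=|f(x)\rangle$ for all $x$. There is an absolute constant $K$ such that for every $n\ge 1$, every permutation $f$ of $\{0,1\}^n$ that moves at most $2^{n/2-1}$ points, i.e. $|\{x: f(x)\ne x\}|\le 2^{n/2-1}$, is implemented by an $n$-wire circuit with at most $$2^{n/2-1}\,(4n+64\log_2 n+K)$$ elementary gates. Moreover $4n+64\log_2 n<8.5\,n$ for every integer $n>100$, so that, apart from the $O(1)$ terms, this improves for $n>100$ on the previously known bound $2^{n/2-1}(8.5\,n+O(1))$. -/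

import Mathlib

noncomputable section

namespace ReversibleCircuit

/-- The strings `{0,1}^n`; they label the computational basis of an `n`-wire circuit. -/
abbrev BitString (n : ℕ) : Type := Fin n → Fin 2

/-- Operators on `n` qubits, as matrices in the computational basis. -/
abbrev Operator (n : ℕ) : Type := Matrix (BitString n) (BitString n) ℂ

/-- The Pauli matrix `X`, i.e. the one-qubit NOT. -/
def notMatrix : Matrix (Fin 2) (Fin 2) ℂ := !![0, 1; 1, 0]

/-- The one-qubit Hadamard matrix. -/
def hadamardMatrix : Matrix (Fin 2) (Fin 2) ℂ :=
  ((1 / Real.sqrt 2 : ℝ) : ℂ) • !![1, 1; 1, -1]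

/-- The matrix `V = ((i + 1) / 2) [[1, -i], [-i, 1]]`, a square root of NOT. -/
def vMatrix : Matrix (Fin 2) (Fin 2) ℂ :=
  ((Complex.I + 1) / 2) • !![1, -Complex.I; -Complex.I, 1]

/-- The three axes of rotation. -/
inductive Axis : Type
  | x
  | y
  | z

/-- The rotation matrix `R_a(θ) = exp(-i θ σ_a / 2)`, with `σ_a` the Pauli matrix of the axis. -/
def rotationMatrix : Axis → ℝ → Matrix (Fin 2) (Fin 2) ℂ
  | Axis.x, θ =>
      !![(Real.cos (θ / 2) : ℂ), -Complex.I * (Real.sin (θ / 2) : ℂ);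
        -Complex.I * (Real.sin (θ / 2) : ℂ), (Real.cos (θ / 2) : ℂ)]
  | Axis.y, θ =>
      !![(Real.cos (θ / 2) : ℂ), -(Real.sin (θ / 2) : ℂ);
        (Real.sin (θ / 2) : ℂ), (Real.cos (θ / 2) : ℂ)]
  | Axis.z, θ =>
      !![Complex.exp (-Complex.I * ((θ / 2 : ℝ) : ℂ)), 0;
        0, Complex.exp (Complex.I * ((θ / 2 : ℝ) : ℂ))]

/-- The one-qubit operator `U` acting on wire `t`, the identity on all the other wires. -/
def onWire {n : ℕ} (U : Matrix (Fin 2) (Fin 2) ℂ) (t : Fin n) : Operator n :=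
  Matrix.of fun x y => if ∀ i, i ≠ t → x i = y i then U (x t) (y t) else 0

/-- The controlled-`U` operator: it applies `U` to wire `t` on the basis states whose bit `c` is
`1`, and fixes the basis states whose bit `c` is `0`. It is used only for `c ≠ t`. -/
def controlledOn {n : ℕ} (U : Matrix (Fin 2) (Fin 2) ℂ) (c t : Fin n) : Operator n :=
  Matrix.of fun x y => if y c = 1 then onWire U t x y else (1 : Operator n) x y

/-- The elementary gates on `n` wires: NOT, Hadamard, rotations about the three axes by angles in
`[0, 2π]`, CNOT and controlled-`V`, placed on arbitrary (for two-wire gates: distinct) wires. -/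
inductive ElementaryGate (n : ℕ) : Type
  | not (t : Fin n)
  | hadamard (t : Fin n)
  | rotation (a : Axis) (θ : ℝ) (hθ : θ ∈ Set.Icc 0 (2 * Real.pi)) (t : Fin n)
  | cnot (c t : Fin n) (hct : c ≠ t)
  | controlledV (c t : Fin n) (hct : c ≠ t)

/-- The operator of an elementary gate. -/
def ElementaryGate.toOperator {n : ℕ} : ElementaryGate n → Operator n
  | .not t => onWire notMatrix t
  | .hadamard t => onWire hadamardMatrix t
  | .rotation a θ _ t => onWire (rotationMatrix a θ) t
  | .cnot c t _ => controlledOn notMatrix c t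
  | .controlledV c t _ => controlledOn vMatrix c t

/-- An `n`-wire circuit without ancillary wires: the list of its gates, in the order in which they
are applied. Its size (number of elementary gates) is the length of the list. -/
abbrev Circuit (n : ℕ) : Type := List (ElementaryGate n)

/-- The operator of a circuit. -/
def circuitOperator {n : ℕ} : Circuit n → Operator n
  | [] => 1
  | g :: C => circuitOperator C * g.toOperator

/-- The permutation matrix `P` of `f`, with `P |x⟩ = |f x⟩`. -/
def permutationOperator {n : ℕ} (f : Equiv.Perm (BitString n)) : Operator n :=
  (f⁻¹).permMatrix ℂ

theorem permutationOperator_apply {n : ℕ} (f : Equiv.Perm (BitString n)) (x y : BitString n) :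
    permutationOperator f x y = if x = f y then 1 else 0 := by
  have h : f⁻¹ x = y ↔ x = f y := Equiv.Perm.inv_eq_iff_eq
  simp [permutationOperator, Equiv.Perm.permMatrix, PEquiv.toMatrix_apply, ← h, eq_comm]

/-- The circuit implements the reversible function `f`: it acts as the permutation matrix of `f`,
up to a global phase. -/
def Implements {n : ℕ} (C : Circuit n) (f : Equiv.Perm (BitString n)) : Prop :=
  ∃ z : ℂ, ‖z‖ = 1 ∧ circuitOperator C = z • permutationOperator f

end ReversibleCircuit

end

namespace ReversibleCircuit

open Matrix

/-! Moved points are repaired 64 at a time, each batch costing `164 * n + O(1)` gates; since `164 /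
64 < 4`, this already gives the bound `4 * n + O(1)` per moved point, and the logarithmic term is
pure slack.

In a batch, pick 64 moved points `x` such that none of their images `f x` is among them, and compose
`f` with an involution `τ` swapping each `x` with `f x` (`exists_reduce_support`). The 128 strings
involved form a table whose columns, one per wire, take at most `2 ^ 128` values. All but boundedly
many wires therefore duplicate another wire, and about `2 * n` gates set them to 1 on every string
of the table. A permutation of the boundedly many remaining wires then moves the strings into a
7-dimensional coordinate subcube (`exists_gather`). There `τ` becomes a single multiply controlled
NOT, which costs `160 * n + 200` because a wire of the subcube can be borrowed
(`cost_mcx_of_dirty`). Undoing the gathering costs another `2 * n + O(1)`.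

Fewer than 192 moved points are left over. They are handled by transpositions of quadratic cost,
negligible against `2 ^ (n / 2 - 1)`.

`Cost` bounds a permutation together with its inverse, so that conjugating never requires inverting
a circuit gate by gate. -/

/-! ### Circuits up to global phase -/

/-- The operator `U` is realized, up to a global phase, by at most `m` elementary gates. -/
def Synth {n : ℕ} (U : Operator n) (m : ℕ) : Prop :=
  ∃ C : Circuit n, C.length ≤ m ∧ ∃ z : ℂ, ‖z‖ = 1 ∧ circuitOperator C = z • U

theorem circuitOperator_append {n : ℕ} (C D : Circuit n) :
    circuitOperator (C ++ D) = circuitOperator D * circuitOperator C := by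
  induction C with
  | nil => simp [circuitOperator]
  | cons g C ih => simp [circuitOperator, ih, Matrix.mul_assoc]

theorem Synth.mul {n : ℕ} {U V : Operator n} {a b : ℕ} (hU : Synth U a) (hV : Synth V b) :
    Synth (U * V) (a + b) := by
  obtain ⟨C, hC, z, hz, hCz⟩ := hU
  obtain ⟨D, hD, w, hw, hDw⟩ := hV
  refine ⟨D ++ C, by simp; omega, z * w, by simp [hz, hw], ?_⟩
  rw [circuitOperator_append, hCz, hDw, smul_mul_smul_comm]

theorem Synth.mono {n : ℕ} {U : Operator n} {a b : ℕ} (hU : Synth U a) (h : a ≤ b) :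
    Synth U b := by
  obtain ⟨C, hC, hz⟩ := hU
  exact ⟨C, hC.trans h, hz⟩

theorem Synth.one {n : ℕ} (m : ℕ) : Synth (1 : Operator n) m :=
  ⟨[], by simp, 1, by simp, by simp [circuitOperator]⟩

theorem synth_gate {n : ℕ} (g : ElementaryGate n) {z : ℂ} (hz : ‖z‖ = 1) {U : Operator n}
    (h : g.toOperator = z • U) : Synth U 1 :=
  ⟨[g], by simp, z, hz, by simp [circuitOperator, h]⟩

/-! ### Permutation matrices and multiply controlled NOTs -/

theorem permutationOperator_mul {n : ℕ} (f g : Equiv.Perm (BitString n)) :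
    permutationOperator (f * g) = permutationOperator f * permutationOperator g := by
  ext x y
  rw [Matrix.mul_apply, Finset.sum_eq_single (g y)]
  · rw [permutationOperator_apply, permutationOperator_apply, permutationOperator_apply, if_pos rfl,
      mul_one]
    rfl
  · intro b _ hb
    rw [permutationOperator_apply g, if_neg hb, mul_zero]
  · simp

theorem permutationOperator_one {n : ℕ} :
    permutationOperator (1 : Equiv.Perm (BitString n)) = 1 := by
  ext x y
  rw [permutationOperator_apply, Matrix.one_apply, Equiv.Perm.one_apply]

/-- Flip the bit `t` of `x` if all bits in `A` (other than `t`) are `1`. -/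
def flipIf {n : ℕ} (A : Finset (Fin n)) (t : Fin n) (x : BitString n) : BitString n :=
  if ∀ i ∈ A, i ≠ t → x i = 1 then Function.update x t (x t + 1) else x

theorem fin_two_add_one_add_one (a : Fin 2) : a + 1 + 1 = a := by
  revert a; decide

theorem flipIf_involutive {n : ℕ} (A : Finset (Fin n)) (t : Fin n) :
    Function.Involutive (flipIf A t) := by
  intro x
  unfold flipIf
  by_cases h : ∀ i ∈ A, i ≠ t → x i = 1
  · have h' : ∀ i ∈ A, i ≠ t → Function.update x t (x t + 1) i = 1 := by
      intro i hi hit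
      rw [Function.update_of_ne hit, h i hi hit]
    rw [if_pos h, if_pos h']
    simp [fin_two_add_one_add_one]
  · rw [if_neg h, if_neg h]

/-- The multiply controlled NOT with controls `A` (other than `t`) and target `t`. -/
def mcx {n : ℕ} (A : Finset (Fin n)) (t : Fin n) : Equiv.Perm (BitString n) :=
  (flipIf_involutive A t).toPerm

theorem mcx_apply {n : ℕ} (A : Finset (Fin n)) (t : Fin n) (x : BitString n) :
    mcx A t x = if ∀ i ∈ A, i ≠ t → x i = 1 then Function.update x t (x t + 1) else x := rfl

theorem mcx_apply_apply {n : ℕ} (A : Finset (Fin n)) (t : Fin n) (x : BitString n)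
    (j : Fin n) :
    mcx A t x j = if j = t ∧ ∀ i ∈ A, i ≠ t → x i = 1 then x j + 1 else x j := by
  rw [mcx_apply]
  by_cases h : ∀ i ∈ A, i ≠ t → x i = 1
  · by_cases hj : j = t
    · subst hj; simp only [if_pos h, true_and, Function.update_self]
    · simp [hj, if_pos h]
  · rw [if_neg h, if_neg fun h' => h h'.2]

theorem mcx_apply_of_ne {n : ℕ} (A : Finset (Fin n)) {t j : Fin n} (h : j ≠ t)
    (x : BitString n) : mcx A t x j = x j := by
  simp [mcx_apply_apply, h]

theorem mcx_mul_self {n : ℕ} (A : Finset (Fin n)) (t : Fin n) : mcx A t * mcx A t = 1 :=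
  Equiv.ext (flipIf_involutive A t)

theorem mcx_inv {n : ℕ} (A : Finset (Fin n)) (t : Fin n) : (mcx A t)⁻¹ = mcx A t :=
  inv_eq_of_mul_eq_one_left (mcx_mul_self A t)

/-! ### Diagonal phases and their synthesis -/

/-- The diagonal operator with phase `w` on the strings whose bits in `A` are all `1`. -/
noncomputable def diagPhase {n : ℕ} (w : ℂ) (A : Finset (Fin n)) : Operator n :=
  Matrix.diagonal fun x => if ∀ i ∈ A, x i = 1 then w else 1

theorem permutationOperator_conj_diagonal {n : ℕ} {f : Equiv.Perm (BitString n)}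
    (hf : f * f = 1) (d : BitString n → ℂ) :
    permutationOperator f * Matrix.diagonal d * permutationOperator f =
      Matrix.diagonal (d ∘ f) := by
  have hf' : ∀ x, f (f x) = x := fun x => by rw [← Equiv.Perm.mul_apply, hf]; rfl
  ext x y
  rw [Matrix.mul_apply]
  simp only [Matrix.mul_diagonal, permutationOperator_apply, Matrix.diagonal_apply,
    Function.comp]
  rw [Finset.sum_eq_single (f y)]
  · by_cases h : x = y
    · simp [h, hf']
    · simp [h, hf']
  · intro b _ hb; simp [hb]
  · simp

theorem onWire_apply {n : ℕ} (U : Matrix (Fin 2) (Fin 2) ℂ) (t : Fin n) (x y : BitString n) :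
    onWire U t x y = if ∀ i, i ≠ t → x i = y i then U (x t) (y t) else 0 := rfl

theorem eq_of_forall_ne {n : ℕ} {t : Fin n} {x y : BitString n}
    (h : ∀ i, i ≠ t → x i = y i) (ht : x t = y t) : x = y := by
  funext i
  by_cases hi : i = t
  · rw [hi, ht]
  · exact h i hi

theorem onWire_mul_apply {n : ℕ} (U : Matrix (Fin 2) (Fin 2) ℂ) (t : Fin n) (M : Operator n)
    (x z : BitString n) :
    (onWire U t * M) x z = ∑ b : Fin 2, U (x t) b * M (Function.update x t b) z := by
  rw [Matrix.mul_apply]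
  symm
  refine Fintype.sum_of_injective (fun b => Function.update x t b) ?_ _ _ ?_ ?_
  · exact Function.update_injective x t
  · intro y hy
    rw [onWire_apply, if_neg, zero_mul]
    intro h
    exact hy ⟨y t, (eq_of_forall_ne (t := t) (fun i hi => by simp [hi, h i hi]) (by simp))⟩
  · intro b
    rw [onWire_apply, if_pos (fun i hi => by simp [hi])]
    simp

theorem exists_exp_eq {w : ℂ} (hw : ‖w‖ = 1) :
    ∃ θ ∈ Set.Icc (0 : ℝ) (2 * Real.pi), Complex.exp (Complex.I * θ) = w := by
  refine ⟨toIcoMod Real.two_pi_pos 0 w.arg, ?_, ?_⟩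
  · have := toIcoMod_mem_Ico Real.two_pi_pos 0 w.arg
    simp only [zero_add] at this
    exact ⟨this.1, this.2.le⟩
  · have h : ((toIcoMod Real.two_pi_pos 0 w.arg : ℝ) : ℂ) =
        w.arg - (toIcoDiv Real.two_pi_pos 0 w.arg : ℤ) * (2 * Real.pi) := by
      rw [toIcoMod]; push_cast; simp
    rw [h]
    have h2 : Complex.I * (w.arg - (toIcoDiv Real.two_pi_pos 0 w.arg : ℤ) * (2 * Real.pi)) =
        w.arg * Complex.I - (toIcoDiv Real.two_pi_pos 0 w.arg : ℤ) * (2 * Real.pi * Complex.I) := by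
      ring
    rw [h2, Complex.exp_periodic.sub_int_mul_eq]
    have := Complex.norm_mul_exp_arg_mul_I w
    rwa [hw, Complex.ofReal_one, one_mul] at this

theorem exists_norm_one_sq_eq {w : ℂ} (hw : ‖w‖ = 1) : ∃ v : ℂ, ‖v‖ = 1 ∧ v * v = w := by
  obtain ⟨v, hv⟩ := IsAlgClosed.exists_eq_mul_self w
  refine ⟨v, ?_, hv.symm⟩
  have : ‖v‖ * ‖v‖ = 1 := by rw [← norm_mul, ← hv, hw]
  nlinarith [norm_nonneg v]

theorem synth_diagPhase_singleton {n : ℕ} {w : ℂ} (hw : ‖w‖ = 1) (t : Fin n) :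
    Synth (diagPhase w {t}) 1 := by
  obtain ⟨θ, hθ, rfl⟩ := exists_exp_eq hw
  -- `R_z(θ)` is `diag(1, e^{iθ})` times the global phase `e^{-iθ/2}`.
  refine synth_gate (.rotation Axis.z θ hθ t) (z := Complex.exp (((-(θ / 2) : ℝ) : ℂ) * Complex.I))
    (Complex.norm_exp_ofReal_mul_I _) ?_
  ext x y
  simp only [ElementaryGate.toOperator, onWire_apply, diagPhase, Matrix.smul_apply,
    Matrix.diagonal_apply, smul_eq_mul, Finset.mem_singleton, forall_eq]
  by_cases hxy : x = y
  · subst hxy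
    simp only [implies_true, if_true, rotationMatrix]
    generalize x t = b
    fin_cases b
    · simp; congr 1; ring
    · simp [← Complex.exp_add]; congr 1; ring
  · rw [if_neg hxy, mul_zero]
    split_ifs with h
    · have : x t ≠ y t := fun ht => hxy (eq_of_forall_ne h ht)
      revert this
      generalize x t = a; generalize y t = b
      fin_cases a <;> fin_cases b <;> simp [rotationMatrix]
    · rfl

theorem onWire_not {n : ℕ} (t : Fin n) :
    onWire notMatrix t = permutationOperator (mcx ∅ t) := by
  ext x y
  rw [onWire_apply, permutationOperator_apply]
  have key : ∀ a b : Fin 2, notMatrix a b = if a = b + 1 then 1 else 0 := by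
    intro a b; fin_cases a <;> fin_cases b <;> simp [notMatrix]
  by_cases h : ∀ i, i ≠ t → x i = y i
  · rw [if_pos h, key]
    congr 1
    refine propext ⟨fun ht => ?_, fun ht => ?_⟩
    · refine eq_of_forall_ne (t := t) (fun i hi => ?_) ?_
      · rw [mcx_apply_of_ne _ hi, h i hi]
      · simp [mcx_apply, ht]
    · rw [ht]; simp [mcx_apply]
  · rw [if_neg h, if_neg]
    rintro rfl
    exact h fun i hi => mcx_apply_of_ne _ hi _

theorem synth_not {n : ℕ} (t : Fin n) : Synth (permutationOperator (mcx ∅ t)) 1 :=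
  synth_gate (.not t) (z := 1) (by simp) (by rw [one_smul]; exact onWire_not t)

theorem synth_cnot {n : ℕ} {c t : Fin n} (hct : c ≠ t) :
    Synth (permutationOperator (mcx {c} t)) 1 := by
  refine synth_gate (.cnot c t hct) (z := 1) (by simp) ?_
  ext x y
  simp only [ElementaryGate.toOperator, controlledOn, Matrix.of_apply, one_smul, onWire_not,
    permutationOperator_apply, Matrix.one_apply]
  by_cases h : y c = 1 <;> simp [h, mcx_apply, hct]

/-- This is `H Z H = X`, under the controls in `A`. -/
theorem hadamard_conj_diagPhase {n : ℕ} {A : Finset (Fin n)} {t : Fin n} (ht : t ∉ A) :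
    onWire hadamardMatrix t * (diagPhase (-1) (insert t A) * onWire hadamardMatrix t) =
      permutationOperator (mcx A t) := by
  ext x z
  rw [onWire_mul_apply, permutationOperator_apply, diagPhase]
  simp only [Matrix.diagonal_mul, onWire_apply]
  have h1 : ∀ b, (∀ i, i ≠ t → Function.update x t b i = z i) ↔ (∀ i, i ≠ t → x i = z i) := by
    intro b
    refine forall_congr' fun i => forall_congr' fun hi => ?_
    rw [Function.update_of_ne hi]
  have h2 : ∀ b, (∀ i ∈ insert t A, Function.update x t b i = 1) ↔
      (b = 1 ∧ ∀ i ∈ A, x i = 1) := by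
    intro b
    rw [Finset.forall_mem_insert, Function.update_self]
    refine and_congr_right fun _ => forall_congr' fun i => forall_congr' fun hi => ?_
    rw [Function.update_of_ne (ne_of_mem_of_not_mem hi ht)]
  have hs : ((1 / Real.sqrt 2 : ℝ) : ℂ) * ((1 / Real.sqrt 2 : ℝ) : ℂ) = 1 / 2 := by
    rw [← Complex.ofReal_mul, div_mul_div_comm, Real.mul_self_sqrt (by norm_num)]; simp
  simp only [h1, h2, Function.update_self]
  by_cases h : ∀ i, i ≠ t → x i = z i
  · have hA : (∀ i ∈ A, i ≠ t → z i = 1) ↔ ∀ i ∈ A, x i = 1 :=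
      forall_congr' fun i => forall_congr' fun hi => by
        have hne : i ≠ t := fun h => ht (h ▸ hi)
        simp [hne, h i hne]
    have hx : x = mcx A t z ↔ x t = if ∀ i ∈ A, x i = 1 then z t + 1 else z t := by
      constructor
      · intro hxz
        have := congrFun hxz t
        simp only [mcx_apply_apply, hA, true_and] at this
        exact this
      · intro hxz
        refine eq_of_forall_ne (t := t) (fun i hi => ?_) ?_
        · rw [mcx_apply_of_ne _ hi, h i hi]
        · simp only [mcx_apply_apply, hA, true_and]
          exact hxz
    simp only [hx, if_pos h]
    generalize x t = a
    generalize z t = b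
    have h00 : hadamardMatrix 0 0 = ((1 / Real.sqrt 2 : ℝ) : ℂ) := by simp [hadamardMatrix]
    have h01 : hadamardMatrix 0 1 = ((1 / Real.sqrt 2 : ℝ) : ℂ) := by simp [hadamardMatrix]
    have h10 : hadamardMatrix 1 0 = ((1 / Real.sqrt 2 : ℝ) : ℂ) := by simp [hadamardMatrix]
    have h11 : hadamardMatrix 1 1 = -((1 / Real.sqrt 2 : ℝ) : ℂ) := by simp [hadamardMatrix]
    generalize ((1 / Real.sqrt 2 : ℝ) : ℂ) = r at hs h00 h01 h10 h11
    have hs2 : r * r + r * r = 1 := by rw [hs]; norm_num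
    by_cases hAx : ∀ i ∈ A, x i = 1
    · simp only [eq_true hAx, and_true, if_true, Fin.sum_univ_two]
      fin_cases a <;> fin_cases b <;> simp [h00, h01, h10, h11, hs2]
    · simp only [eq_false hAx, and_false, if_false, Fin.sum_univ_two]
      fin_cases a <;> fin_cases b <;> simp [h00, h01, h10, h11, hs2]
  · rw [if_neg]
    · simp [if_neg h]
    · rintro rfl
      exact h fun i hi => mcx_apply_of_ne _ hi _

theorem synth_mcx_of_diagPhase {n m : ℕ} {A : Finset (Fin n)} {t : Fin n} (ht : t ∉ A)
    (h : Synth (diagPhase (-1) (insert t A)) m) :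
    Synth (permutationOperator (mcx A t)) (m + 2) := by
  have hH : Synth (onWire hadamardMatrix t) 1 :=
    synth_gate (.hadamard t) (z := 1) (by simp) (by simp [ElementaryGate.toOperator])
  rw [← hadamard_conj_diagPhase ht]
  exact (hH.mul (h.mul hH)).mono (by omega)

/-- For bits, `a + b - (a ⊕ b) = 2ab`; read it in the exponent of `v`. The conjugated factor
supplies `a ⊕ b`. -/
theorem diagPhase_pair {n : ℕ} {v : ℂ} (hv : v ≠ 0) {c t : Fin n} (hct : c ≠ t) :
    diagPhase (v * v) {c, t} = diagPhase v {c} * (diagPhase v {t} *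
      (permutationOperator (mcx {c} t) * diagPhase v⁻¹ {t} *
        permutationOperator (mcx {c} t))) := by
  simp only [diagPhase]
  rw [permutationOperator_conj_diagonal (mcx_mul_self _ _), Matrix.diagonal_mul_diagonal,
    Matrix.diagonal_mul_diagonal]
  congr 1
  funext x
  simp only [Function.comp, Finset.mem_singleton, forall_eq, Finset.mem_insert, forall_eq_or_imp,
    mcx_apply_apply, true_and]
  generalize x c = a
  generalize x t = b
  fin_cases a <;> fin_cases b <;> simp [hv, hct]

theorem synth_diagPhase_pair {n : ℕ} {w : ℂ} (hw : ‖w‖ = 1) {c t : Fin n} (hct : c ≠ t) :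
    Synth (diagPhase w {c, t}) 5 := by
  obtain ⟨v, hv, rfl⟩ := exists_norm_one_sq_eq hw
  have hv0 : v ≠ 0 := by rintro rfl; simp at hv
  rw [diagPhase_pair hv0 hct]
  have hv' : ‖v⁻¹‖ = 1 := by simp [hv]
  exact (synth_diagPhase_singleton hv c).mul ((synth_diagPhase_singleton hv t).mul
    (((synth_cnot hct).mul (synth_diagPhase_singleton hv' t)).mul (synth_cnot hct)))

/-- The same identity with `a` the bit of `c` and `b` the conjunction of the bits in `B`, everything
controlled by `t`. -/
theorem diagPhase_insert_insert {n : ℕ} {v : ℂ} (hv : v ≠ 0) {B : Finset (Fin n)} {c t : Fin n}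
    (hct : c ≠ t) (hc : c ∉ B) :
    diagPhase (v * v) (insert t (insert c B)) = diagPhase v {c, t} * (diagPhase v (insert t B) *
      (permutationOperator (mcx B c) * diagPhase v⁻¹ {c, t} *
        permutationOperator (mcx B c))) := by
  simp only [diagPhase]
  rw [permutationOperator_conj_diagonal (mcx_mul_self _ _), Matrix.diagonal_mul_diagonal,
    Matrix.diagonal_mul_diagonal]
  congr 1
  funext x
  have hB : (∀ i ∈ B, i ≠ c → x i = 1) ↔ ∀ i ∈ B, x i = 1 :=
    forall_congr' fun i => forall_congr' fun hi => by
      have : i ≠ c := fun h => hc (h ▸ hi)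
      simp [this]
  simp only [Function.comp, Finset.mem_singleton, forall_eq, Finset.mem_insert, forall_eq_or_imp,
    mcx_apply_apply, true_and, hct.symm, false_and, if_false, hB]
  generalize x c = a
  generalize x t = b
  by_cases h : ∀ i ∈ B, x i = 1
  · simp only [eq_true h, and_true, if_true]
    fin_cases a <;> fin_cases b <;> simp [hv]
  · simp only [eq_false h, and_false, if_false]
    fin_cases a <;> fin_cases b <;> simp [hv]

theorem synth_diagPhase_insert {n m k : ℕ} {B : Finset (Fin n)} {c t : Fin n} (hct : c ≠ t)
    (hc : c ∉ B) (hM : Synth (permutationOperator (mcx B c)) k)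
    (hB : ∀ v : ℂ, ‖v‖ = 1 → Synth (diagPhase v (insert t B)) m) {w : ℂ} (hw : ‖w‖ = 1) :
    Synth (diagPhase w (insert t (insert c B))) (m + (2 * k + 10)) := by
  obtain ⟨v, hv, rfl⟩ := exists_norm_one_sq_eq hw
  have hv0 : v ≠ 0 := by rintro rfl; simp at hv
  rw [diagPhase_insert_insert hv0 hct hc]
  have hv' : ‖v⁻¹‖ = 1 := by simp [hv]
  exact ((synth_diagPhase_pair hv hct).mul ((hB v hv).mul
    ((hM.mul (synth_diagPhase_pair hv' hct)).mul hM))).mono (by omega)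

/-! ### Linear-size multiply controlled NOTs with dirty wires -/

/-- Both `f` and `f⁻¹` are implemented by circuits with at most `m` elementary gates. -/
def Cost {n : ℕ} (f : Equiv.Perm (BitString n)) (m : ℕ) : Prop :=
  Synth (permutationOperator f) m ∧ Synth (permutationOperator f⁻¹) m

theorem Cost.mul {n : ℕ} {f g : Equiv.Perm (BitString n)} {a b : ℕ} (hf : Cost f a)
    (hg : Cost g b) : Cost (f * g) (a + b) := by
  refine ⟨?_, ?_⟩
  · rw [permutationOperator_mul]; exact hf.1.mul hg.1
  · rw [_root_.mul_inv_rev, permutationOperator_mul, add_comm]; exact hg.2.mul hf.2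

theorem Cost.inv {n : ℕ} {f : Equiv.Perm (BitString n)} {a : ℕ} (hf : Cost f a) :
    Cost f⁻¹ a := ⟨hf.2, by rw [inv_inv]; exact hf.1⟩

theorem Cost.mono {n : ℕ} {f : Equiv.Perm (BitString n)} {a b : ℕ} (hf : Cost f a)
    (h : a ≤ b) : Cost f b := ⟨hf.1.mono h, hf.2.mono h⟩

theorem Cost.one {n : ℕ} (m : ℕ) : Cost (1 : Equiv.Perm (BitString n)) m := by
  constructor
  · rw [permutationOperator_one]; exact Synth.one m
  · rw [inv_one, permutationOperator_one]; exact Synth.one m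

theorem cost_mcx {n m : ℕ} {A : Finset (Fin n)} {t : Fin n}
    (h : Synth (permutationOperator (mcx A t)) m) : Cost (mcx A t) m :=
  ⟨h, by rwa [mcx_inv]⟩

theorem cost_not {n : ℕ} (t : Fin n) : Cost (mcx ∅ t) 1 := cost_mcx (synth_not t)

theorem cost_cnot {n : ℕ} {c t : Fin n} (hct : c ≠ t) : Cost (mcx {c} t) 1 :=
  cost_mcx (synth_cnot hct)

/-- The count is `5 + (2 * 1 + 10)` for the three-wire phase plus two Hadamards. -/
theorem cost_toffoli {n : ℕ} {a b t : Fin n} (hab : a ≠ b) (hat : a ≠ t) (hbt : b ≠ t) :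
    Cost (mcx {a, b} t) 19 :=
  cost_mcx (synth_mcx_of_diagPhase (by simp [hat.symm, hbt.symm])
    (synth_diagPhase_insert (m := 5) (k := 1) hat (by simpa using hab) (synth_cnot hab.symm)
      (fun v hv => synth_diagPhase_pair hv hbt.symm) (by simp)))

theorem mcx_apply_target {n : ℕ} {A : Finset (Fin n)} {t : Fin n} (ht : t ∉ A)
    (x : BitString n) :
    mcx A t x t = if ∀ i ∈ A, x i = 1 then x t + 1 else x t := by
  have hA : (∀ i ∈ A, i ≠ t → x i = 1) ↔ ∀ i ∈ A, x i = 1 :=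
    forall_congr' fun i => forall_congr' fun hi => by
      simp [ne_of_mem_of_not_mem hi ht]
  simp only [mcx_apply_apply, hA, true_and]

theorem forall_mcx_apply {n : ℕ} {A : Finset (Fin n)} {t : Fin n} (ht : t ∉ A)
    (B : Finset (Fin n)) (x : BitString n) :
    (∀ i ∈ A, mcx B t x i = 1) ↔ ∀ i ∈ A, x i = 1 :=
  forall_congr' fun i => forall_congr' fun hi => by
    rw [mcx_apply_of_ne _ (ne_of_mem_of_not_mem hi ht)]

theorem commute_mcx {n : ℕ} {A B : Finset (Fin n)} {t u : Fin n} (htA : t ∉ A) (huB : u ∉ B)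
    (htB : t ∉ B) (huA : u ∉ A) (htu : t ≠ u) : Commute (mcx A t) (mcx B u) := by
  refine Equiv.ext fun x => funext fun j => ?_
  simp only [Equiv.Perm.mul_apply]
  by_cases hjt : j = t
  · subst hjt
    simp only [mcx_apply_target htA, mcx_apply_of_ne _ htu, forall_mcx_apply huA]
  · by_cases hju : j = u
    · subst hju
      simp only [mcx_apply_target huB, mcx_apply_of_ne _ hjt, forall_mcx_apply htB]
    · simp only [mcx_apply_of_ne _ hju, mcx_apply_of_ne _ hjt]

/-- With `α`, `β` the conjunctions over `A`, `B`, the target receives `β(z + α) + βz = αβ` modulo 2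
whatever `z` held, and `z` is restored. Hence a wire in an unknown state can serve as workspace. -/
theorem mcx_commutator {n : ℕ} {A B : Finset (Fin n)} {t z : Fin n} (htA : t ∉ A) (htB : t ∉ B)
    (hzA : z ∉ A) (hzB : z ∉ B) (hzt : z ≠ t) :
    mcx (insert z B) t * mcx A z * mcx (insert z B) t * mcx A z = mcx (A ∪ B) t := by
  have ht1 : t ∉ insert z B := by simp [hzt.symm, htB]
  have ht2 : t ∉ A ∪ B := by simp [htA, htB]
  refine Equiv.ext fun x => funext fun j => ?_
  simp only [Equiv.Perm.mul_apply]
  by_cases hjt : j = t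
  · subst hjt
    simp only [mcx_apply_target ht1, mcx_apply_target ht2, mcx_apply_target hzA,
      mcx_apply_of_ne _ hzt.symm, mcx_apply_of_ne _ hzt, Finset.forall_mem_insert,
      forall_mcx_apply hzB, forall_mcx_apply htB, forall_mcx_apply htA, forall_mcx_apply hzA,
      Finset.forall_mem_union]
    generalize x z = a
    generalize x j = b
    by_cases h1 : ∀ i ∈ A, x i = 1
    · by_cases h2 : ∀ i ∈ B, x i = 1
      · simp only [eq_true h1, eq_true h2, and_true, if_true]
        revert a b; decide
      · simp only [eq_false h2, and_false, if_false]
    · by_cases h2 : ∀ i ∈ B, x i = 1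
      · simp only [eq_false h1, eq_true h2, and_true, if_false]
        revert a b; decide
      · simp only [eq_false h2, and_false, if_false]
  · by_cases hjz : j = z
    · subst hjz
      simp only [mcx_apply_of_ne _ hzt, mcx_apply_target hzA, forall_mcx_apply htA,
        forall_mcx_apply hzA]
      split_ifs
      · exact fin_two_add_one_add_one _
      · rfl
    · simp only [mcx_apply_of_ne _ hjt, mcx_apply_of_ne _ hjz]

/-- The ladder: with at least `|A| - 1` dirty wires `Z`, a multiply controlled NOT is built from
linearly many gates. The operation `R` cleans up the wires of `Z`. -/
theorem exists_ladder {n : ℕ} (m : ℕ) : ∀ (A Z : Finset (Fin n)) (t : Fin n), A.card = m + 1 →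
    m ≤ Z.card → t ∉ A → t ∉ Z → Disjoint A Z → ∃ R : Equiv.Perm (BitString n),
      R * R = 1 ∧ Cost R (40 * m) ∧ Cost (mcx A t * R) (40 * m + 1) ∧
      ∀ (B : Finset (Fin n)) (u : Fin n), u ∉ A → u ∉ Z → u ∉ B → Disjoint B Z →
        Commute R (mcx B u) := by
  induction m with
  | zero =>
    intro A Z t hA _ htA _ _
    obtain ⟨a, rfl⟩ := Finset.card_eq_one.mp hA
    have hat : a ≠ t := by rintro rfl; simp at htA
    exact ⟨1, one_mul 1, Cost.one _, by rw [mul_one]; exact cost_cnot hat,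
      fun B u _ _ _ _ => Commute.one_left _⟩
  | succ m ih =>
    intro A Z t hA hZ htA htZ hAZ
    obtain ⟨c, A', hcA', rfl, hA'⟩ := Finset.card_eq_succ.mp hA
    obtain ⟨z, hz⟩ : Z.Nonempty := Finset.card_pos.mp (by omega)
    obtain ⟨Z', hzZ', rfl⟩ : ∃ Z', z ∉ Z' ∧ insert z Z' = Z :=
      ⟨Z.erase z, Finset.notMem_erase _ _, Finset.insert_erase hz⟩
    rw [Finset.card_insert_of_notMem hzZ'] at hZ
    simp only [Finset.disjoint_insert_left, Finset.disjoint_insert_right, Finset.mem_insert,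
      not_or] at hAZ htA htZ
    obtain ⟨⟨hzc, hzA'⟩, hcZ', hAZ'⟩ := hAZ
    obtain ⟨htc, htA'⟩ := htA
    obtain ⟨htz, htZ'⟩ := htZ
    obtain ⟨R, hRR, hR, hRz, hcomm⟩ := ih A' Z' z hA' (by omega) hzA' hzZ' hAZ'
    have hRA : Commute R (mcx A' z) := hcomm A' z hzA' hzZ' hzA' hAZ'
    have hcz' : c ≠ z := Ne.symm hzc
    have hT : Cost (mcx {z, c} t) 19 := cost_toffoli hcz'.symm (Ne.symm htz) (Ne.symm htc)
    have hRT : Commute R (mcx {z, c} t) := hcomm _ _ htA' htZ' (by simp [htz, htc])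
      (by simp [hzZ', hcZ'])
    -- Leaving `mcx A' z * R` uncleaned removes one factor from the commutator, so the recursion
    -- calls the smaller circuit once per level and stays linear. That leftover is the next cleanup
    -- operation.
    have hkey : mcx (insert c A') t * (mcx A' z * R) =
        mcx {z, c} t * (mcx A' z * R) * mcx {z, c} t := by
      have := mcx_commutator (A := A') (B := {c}) (t := t) (z := z) htA' (by simpa using htc) hzA'
        (by simpa using hcz'.symm) (Ne.symm htz)
      rw [Finset.union_comm, ← Finset.insert_eq] at this
      rw [← this, mul_assoc _ (mcx A' z) (mcx A' z * R), ← mul_assoc (mcx A' z) (mcx A' z) R,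
        mcx_mul_self, one_mul]
      simp only [mul_assoc]
      rw [hRT.eq]
    refine ⟨mcx A' z * R, ?_, hRz.mono (by omega), ?_, ?_⟩
    · rw [mul_assoc, ← mul_assoc R, hRA.eq, mul_assoc (mcx A' z) R R, hRR, mul_one, mcx_mul_self]
    · rw [hkey]
      exact ((hT.mul hRz).mul hT).mono (by omega)
    · intro B u huA huZ huB hBZ
      simp only [Finset.disjoint_insert_right, Finset.mem_insert, not_or] at huA huZ hBZ
      exact (commute_mcx hzA' huB hBZ.1 huA.2 (Ne.symm huZ.1)).mul_left
        (hcomm B u huA.2 huZ.2 huB hBZ.2)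

/-- Linear cost with sufficiently many dirty wires. -/
theorem cost_mcx_of_card_le {n : ℕ} {A Z : Finset (Fin n)} {t : Fin n} (h : A.card ≤ Z.card + 1)
    (htA : t ∉ A) (htZ : t ∉ Z) (hAZ : Disjoint A Z) : Cost (mcx A t) (80 * A.card + 1) := by
  rcases A.eq_empty_or_nonempty with rfl | hne
  · exact (cost_not t).mono (by omega)
  · have hpos := hne.card_pos
    obtain ⟨R, hRR, hR, hRt, -⟩ := exists_ladder (A.card - 1) A Z t (by omega) (by omega) htA htZ hAZ
    have : mcx A t = mcx A t * R * R := by rw [mul_assoc, hRR, mul_one]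
    rw [this]
    exact (hRt.mul hR).mono (by omega)

/-- Linear cost with one dirty wire. -/
theorem cost_mcx_of_dirty {n : ℕ} {A : Finset (Fin n)} {t z : Fin n} (htA : t ∉ A) (hzA : z ∉ A)
    (hzt : z ≠ t) : Cost (mcx A t) (160 * n + 200) := by
  -- Split the controls in half: while one half is in use, the wires of the other half are idle and
  -- serve as dirty wires for the ladder.
  obtain ⟨A₁, hA₁, hcard⟩ := Finset.exists_subset_card_eq
    (show (A.card + 1) / 2 ≤ A.card by omega)
  have hA : A₁ ∪ (A \ A₁) = A := Finset.union_sdiff_of_subset hA₁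
  have hc2 : (A \ A₁).card = A.card - (A.card + 1) / 2 := by
    rw [Finset.card_sdiff_of_subset hA₁, hcard]
  have hdis : Disjoint A₁ (A \ A₁) := Finset.disjoint_sdiff
  set A₂ := A \ A₁ with hA₂
  have h1 : ∀ i, i ∉ A → i ∉ A₁ ∧ i ∉ A₂ := fun i hi => by rw [← hA] at hi; simpa using hi
  obtain ⟨ht1, ht2⟩ := h1 t htA
  obtain ⟨hz1, hz2⟩ := h1 z hzA
  have hcz : (insert z A₂).card = A₂.card + 1 := Finset.card_insert_of_notMem hz2
  have hct : (insert t A₂).card = A₂.card + 1 := Finset.card_insert_of_notMem ht2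
  have hM : Cost (mcx A₁ z) (80 * A₁.card + 1) :=
    cost_mcx_of_card_le (Z := insert t A₂) (by omega) hz1 (by simp [hzt, hz2])
      (by simp [ht1, hdis])
  have hT : Cost (mcx (insert z A₂) t) (80 * (insert z A₂).card + 1) :=
    cost_mcx_of_card_le (Z := A₁) (by omega) (by simp [hzt.symm, ht2]) ht1
      (by simp [hz1, hdis.symm])
  have hn : A.card ≤ n := by simpa using Finset.card_le_univ A
  rw [← hA, ← mcx_commutator ht1 ht2 hz1 hz2 hzt]
  exact (((hT.mul hM).mul hT).mul hM).mono (by omega)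

/-! ### Multiply controlled NOTs without a spare wire -/

/-- Peeling off a control `c` needs two NOTs targeting `c` with controls `B`; these leave `t` idle,
so `t` itself is the dirty wire. Each step costs `2 * (160 * n + 200) + 10`. -/
theorem synth_diagPhase_of_mem {n : ℕ} (t : Fin n) (A : Finset (Fin n)) : t ∉ A →
    ∀ w : ℂ, ‖w‖ = 1 → Synth (diagPhase w (insert t A)) (1 + A.card * (320 * n + 410)) := by
  induction A using Finset.induction_on with
  | empty => intro _ w hw; simpa using synth_diagPhase_singleton hw t
  | insert c B hc ih =>
    intro ht w hw
    simp only [Finset.mem_insert, not_or] at ht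
    rw [Finset.card_insert_of_notMem hc]
    refine (synth_diagPhase_insert (Ne.symm ht.1) hc
      (cost_mcx_of_dirty hc ht.2 ht.1).1 (ih ht.2) hw).mono (by ring_nf; omega)

/-- Quadratic cost without any further wire. -/
theorem cost_mcx_quadratic {n : ℕ} {A : Finset (Fin n)} {t : Fin n} (ht : t ∉ A) :
    Cost (mcx A t) (733 * n ^ 2) := by
  have h := synth_mcx_of_diagPhase ht (synth_diagPhase_of_mem t A ht (-1) (by simp))
  refine (cost_mcx h).mono ?_
  have h1 : A.card ≤ n := by simpa using Finset.card_le_univ A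
  have h2 : 1 ≤ n := t.pos
  nlinarith [Nat.mul_le_mul_right (320 * n + 410) h1]

/-! ### Permutations acting on a subset of the wires -/

/-- Simultaneous affine updates of the bits in `S`, each by a bit outside `S`. -/
theorem exists_shear {n : ℕ} (ρ : Fin n → Fin n) (a b : Fin n → Fin 2) (S : Finset (Fin n)) :
    (∀ i ∈ S, ρ i ∉ S) → ∃ g : Equiv.Perm (BitString n), Cost g (2 * S.card) ∧
      ∀ x i, g x i = if i ∈ S then x i + a i * x (ρ i) + b i else x i := by
  induction S using Finset.induction_on with
  | empty => intro _; exact ⟨1, Cost.one _, by simp⟩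
  | insert i S hi ih =>
    intro hρ
    obtain ⟨g, hg, hgx⟩ := ih fun j hj h =>
      hρ j (Finset.mem_insert_of_mem hj) (Finset.mem_insert_of_mem h)
    have hρi := hρ i (Finset.mem_insert_self _ _)
    simp only [Finset.mem_insert, not_or] at hρi
    have hstep : ∃ h : Equiv.Perm (BitString n), Cost h 2 ∧
        ∀ x j, h x j = if j = i then x i + a i * x (ρ i) + b i else x j := by
      have hA : ∃ h : Equiv.Perm (BitString n), Cost h 1 ∧
          ∀ x j, h x j = if j = i then x i + a i * x (ρ i) else x j := by
        rcases (by generalize a i = c; revert c; decide : a i = 0 ∨ a i = 1) with h | h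
        · refine ⟨1, Cost.one _, fun x j => ?_⟩
          rw [h]; split_ifs with hj <;> simp [hj]
        · refine ⟨mcx {ρ i} i, cost_cnot hρi.1, fun x j => ?_⟩
          rw [h, mcx_apply_apply]
          by_cases hj : j = i
          · subst hj
            simp only [Finset.mem_singleton, forall_eq, true_and, if_true]
            generalize x (ρ j) = c
            generalize x j = c'
            simp only [ne_eq, hρi.1, not_false_eq_true, forall_true_left]
            revert c c'; decide
          · simp [hj]
      have hB : ∃ h : Equiv.Perm (BitString n), Cost h 1 ∧
          ∀ x j, h x j = if j = i then x i + b i else x j := by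
        rcases (by generalize b i = c; revert c; decide : b i = 0 ∨ b i = 1) with h | h
        · refine ⟨1, Cost.one _, fun x j => ?_⟩
          rw [h]; split_ifs with hj <;> simp [hj]
        · refine ⟨mcx ∅ i, cost_not i, fun x j => ?_⟩
          rw [h, mcx_apply_apply]
          by_cases hj : j = i
          · subst hj; simp
          · simp [hj]
      obtain ⟨hA, hAc, hAx⟩ := hA
      obtain ⟨hB, hBc, hBx⟩ := hB
      refine ⟨hB * hA, hBc.mul hAc, fun x j => ?_⟩
      rw [Equiv.Perm.mul_apply, hBx, hAx, if_pos rfl]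
      split_ifs with hj
      · rfl
      · rw [hAx, if_neg hj]
    obtain ⟨h, hh, hhx⟩ := hstep
    refine ⟨h * g, (hh.mul hg).mono (by rw [Finset.card_insert_of_notMem hi]; omega),
      fun x j => ?_⟩
    rw [Equiv.Perm.mul_apply, hhx]
    by_cases hj : j = i
    · subst hj
      simp [hgx, hi, hρi.2]
    · simp [hgx, hj]

/-- `g` acts as `σ` on the wires enumerated by `e` and fixes all other wires. -/
def Lifts {n : ℕ} {ι : Type*} (e : ι → Fin n) (σ : Equiv.Perm (ι → Fin 2))
    (g : Equiv.Perm (BitString n)) : Prop :=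
  ∀ x : BitString n, (∀ i, g x (e i) = σ (fun i => x (e i)) i) ∧
    ∀ j, (∀ i, e i ≠ j) → g x j = x j

theorem Lifts.mul {n : ℕ} {ι : Type*} {e : ι → Fin n} {σ τ : Equiv.Perm (ι → Fin 2)}
    {g h : Equiv.Perm (BitString n)} (hg : Lifts e σ g) (hh : Lifts e τ h) :
    Lifts e (σ * τ) (g * h) := by
  intro x
  have hx : (fun i => h x (e i)) = τ fun i => x (e i) := funext (hh x).1
  refine ⟨fun i => ?_, fun j hj => ?_⟩
  · rw [Equiv.Perm.mul_apply, (hg (h x)).1, hx, Equiv.Perm.mul_apply]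
  · rw [Equiv.Perm.mul_apply, (hg (h x)).2 j hj, (hh x).2 j hj]

/-- A shear controlled by a wire `t` where `u` and `v` differ makes both strings all ones off `t`.
The transposition is then a multiply controlled NOT on `t`, conjugated by the shear. -/
theorem exists_lift_swap {n T : ℕ} {ι : Type*} [Fintype ι] [DecidableEq ι] {e : ι → Fin n}
    (he : Function.Injective e)
    (hT : ∀ t, Cost (mcx ((Finset.univ.image e).erase t) t) T) {u v : ι → Fin 2} (huv : u ≠ v) :
    ∃ g, Lifts e (Equiv.swap u v) g ∧ Cost g (4 * Fintype.card ι + T) := by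
  obtain ⟨t, ht⟩ := Function.ne_iff.mp huv
  -- Affine interpolation over `F₂`: solvable because `u t ≠ v t`.
  have hab : ∀ i, ∃ a b : Fin 2, u i + a * u t + b = 1 ∧ v i + a * v t + b = 1 := by
    intro i
    revert ht
    generalize u t = p; generalize v t = q; generalize u i = r; generalize v i = s
    revert p q r s; decide
  choose a b hau hbv using hab
  set S := (Finset.univ.image e).erase (e t) with hS
  have htS : e t ∉ S := Finset.notMem_erase _ _
  have hSmem : ∀ j, j ∈ S ↔ ∃ i, i ≠ t ∧ e i = j := by
    intro j
    simp only [hS, Finset.mem_erase, Finset.mem_image, Finset.mem_univ, true_and]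
    constructor
    · rintro ⟨hj, i, rfl⟩
      exact ⟨i, fun h => hj (by rw [h]), rfl⟩
    · rintro ⟨i, hi, rfl⟩
      exact ⟨fun h => hi (he h), i, rfl⟩
  obtain ⟨s, hs, hsx⟩ := exists_shear (fun _ => e t) (Function.extend e a 0)
    (Function.extend e b 0) S (fun _ _ => htS)
  have hst : ∀ x, s x (e t) = x (e t) := fun x => by rw [hsx, if_neg htS]
  have hsi : ∀ x i, i ≠ t → s x (e i) = x (e i) + a i * x (e t) + b i := fun x i hi => by
    rw [hsx, if_pos ((hSmem _).2 ⟨i, hi, rfl⟩), he.extend_apply, he.extend_apply]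
  have hcard : S.card ≤ Fintype.card ι := (Finset.card_erase_le).trans
    (Finset.card_image_le.trans (by simp))
  refine ⟨s⁻¹ * mcx S (e t) * s, fun x => ?_, ((hs.inv.mul (hT _)).mul hs).mono (by omega)⟩
  have hones : ∀ y : BitString n, (∀ j ∈ S, s y j = 1) ↔
      ((fun i => y (e i)) = u ∨ (fun i => y (e i)) = v) := by
    intro y
    have hS' : (∀ j ∈ S, s y j = 1) ↔ ∀ i, i ≠ t → y (e i) + a i * y (e t) + b i = 1 := by
      constructor
      · intro h i hi
        rw [← hsi y i hi]
        exact h _ ((hSmem _).2 ⟨i, hi, rfl⟩)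
      · intro h j hj
        obtain ⟨i, hi, rfl⟩ := (hSmem j).1 hj
        rw [hsi y i hi, h i hi]
    rw [hS']
    have hcancel : ∀ p q c d : Fin 2, p + c + d = 1 → q + c + d = 1 → p = q := by decide
    constructor
    · intro h
      have hcase : y (e t) = u t ∨ y (e t) = v t := by
        revert ht
        generalize u t = p; generalize v t = q; generalize y (e t) = r
        revert p q r; decide
      refine hcase.imp (fun hyt => funext fun i => ?_) (fun hyt => funext fun i => ?_)
      · by_cases hi : i = t
        · rw [hi, hyt]
        · have := h i hi
          rw [hyt] at this
          exact hcancel _ _ _ _ this (hau i)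
      · by_cases hi : i = t
        · rw [hi, hyt]
        · have := h i hi
          rw [hyt] at this
          exact hcancel _ _ _ _ this (hbv i)
    · rintro (h | h) i -
      · rw [← hau i, ← h]
      · rw [← hbv i, ← h]
  have hflip : u t + 1 = v t ∧ v t + 1 = u t := by
    revert ht
    generalize u t = p; generalize v t = q
    revert p q; decide
  -- `y` is the required image of `x`; after conjugation it suffices that the controlled NOT sends
  -- `s x` to `s y`.
  set y : BitString n := Function.extend e (Equiv.swap u v fun i => x (e i)) x with hy
  have hye : ∀ i, y (e i) = Equiv.swap u v (fun i => x (e i)) i := fun i => by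
    rw [hy, he.extend_apply]
  have hyj : ∀ j, (∀ i, e i ≠ j) → y j = x j := fun j hj => by
    rw [hy, Function.extend_apply' _ _ _ (by simpa using hj)]
  have hmove : ∀ w w' : ι → Fin 2, (w = u ∧ w' = v ∨ w = v ∧ w' = u) → (fun i => x (e i)) = w →
      (∀ i, y (e i) = w' i) → mcx S (e t) (s x) = s y := by
    intro w w' hw hxw hyw
    have hx1 : ∀ j ∈ S, s x j = 1 := (hones x).2 (by
      rw [hxw]; exact hw.imp (fun h => h.1) (fun h => h.1))
    have hy1 : ∀ j ∈ S, s y j = 1 := (hones y).2 (by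
      rw [show (fun i => y (e i)) = w' from funext hyw]
      exact hw.symm.imp (fun h => h.2) (fun h => h.2))
    have hww : w t + 1 = w' t := by
      rcases hw with ⟨rfl, rfl⟩ | ⟨rfl, rfl⟩
      · exact hflip.1
      · exact hflip.2
    funext j
    by_cases hjS : j ∈ S
    · rw [mcx_apply_of_ne _ (ne_of_mem_of_not_mem hjS htS), hx1 j hjS, hy1 j hjS]
    · by_cases hjt : j = e t
      · subst hjt
        rw [mcx_apply_target htS, if_pos hx1, hst, hst, hyw, ← hww, ← hxw]
      · have hje : ∀ i, e i ≠ j := by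
          intro i hij
          by_cases hi : i = t
          · exact hjt (by rw [← hij, hi])
          · exact hjS ((hSmem j).2 ⟨i, hi, hij⟩)
        rw [mcx_apply_of_ne _ hjt, hsx, hsx, if_neg hjS, if_neg hjS, hyj j hje]
  have hkey : mcx S (e t) (s x) = s y := by
    by_cases hxu : (fun i => x (e i)) = u
    · refine hmove u v (Or.inl ⟨rfl, rfl⟩) hxu fun i => ?_
      rw [hye, hxu, Equiv.swap_apply_left]
    · by_cases hxv : (fun i => x (e i)) = v
      · refine hmove v u (Or.inr ⟨rfl, rfl⟩) hxv fun i => ?_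
        rw [hye, hxv, Equiv.swap_apply_right]
      · have hyx : y = x := by
          funext j
          by_cases hj : ∃ i, e i = j
          · obtain ⟨i, rfl⟩ := hj
            rw [hye, Equiv.swap_apply_of_ne_of_ne hxu hxv]
          · exact hyj j (by simpa using hj)
        have hno : ¬ ∀ j ∈ S, s x j = 1 := fun h => ((hones x).1 h).elim hxu hxv
        rw [hyx]
        funext j
        by_cases hjt : j = e t
        · subst hjt
          rw [mcx_apply_target htS, if_neg hno]
        · rw [mcx_apply_of_ne _ hjt]
  have hgx : (s⁻¹ * mcx S (e t) * s) x = y := by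
    rw [Equiv.Perm.mul_apply, Equiv.Perm.mul_apply, hkey]
    exact s.symm_apply_apply y
  rw [hgx]
  exact ⟨hye, hyj⟩

/-- One transposition per moved point: composing with `swap x (σ x)` fixes `x` and moves no new
point. -/
theorem exists_lift {n T : ℕ} {ι : Type*} [Fintype ι] [DecidableEq ι] {e : ι → Fin n}
    (he : Function.Injective e)
    (hT : ∀ t, Cost (mcx ((Finset.univ.image e).erase t) t) T) (m : ℕ) :
    ∀ σ : Equiv.Perm (ι → Fin 2), σ.support.card ≤ m →
      ∃ g, Lifts e σ g ∧ Cost g (m * (4 * Fintype.card ι + T)) := by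
  induction m with
  | zero =>
    intro σ hσ
    have : σ = 1 := by simpa using hσ
    subst this
    exact ⟨1, fun x => ⟨fun i => rfl, fun j _ => rfl⟩, Cost.one _⟩
  | succ m ih =>
    intro σ hσ
    by_cases h1 : σ = 1
    · subst h1
      exact ⟨1, fun x => ⟨fun i => rfl, fun j _ => rfl⟩, Cost.one _⟩
    · obtain ⟨x, hx⟩ : ∃ x, σ x ≠ x := by
        by_contra! h
        exact h1 (Equiv.ext h)
      have hlt := Equiv.Perm.card_support_swap_mul hx
      obtain ⟨g, hg, hgc⟩ := ih (Equiv.swap x (σ x) * σ) (by omega)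
      obtain ⟨h, hh, hhc⟩ := exists_lift_swap he hT hx.symm
      refine ⟨h * g, ?_, (hhc.mul hgc).mono (le_of_eq (by ring))⟩
      have := hh.mul hg
      rwa [← mul_assoc, Equiv.swap_mul_self, one_mul] at this

/-- Every permutation with small support has a circuit of quadratic size per moved point. -/
theorem cost_of_card_support_le {n m : ℕ} (f : Equiv.Perm (BitString n))
    (hf : f.support.card ≤ m) : Cost f (m * (4 * n + 733 * n ^ 2)) := by
  obtain ⟨g, hg, hgc⟩ := exists_lift (e := (id : Fin n → Fin n)) Function.injective_id
    (fun t => cost_mcx_quadratic (Finset.notMem_erase t _)) m f hf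
  have : g = f := Equiv.ext fun x => funext fun i => (hg x).1 i
  rw [← this]
  simpa using hgc

/-! ### Gathering strings into a subcube and swapping them in pairs -/

/-- Wires on which all given strings agree are merged: few representatives suffice. -/
theorem exists_representatives {n : ℕ} {J : Type*} [Fintype J] [DecidableEq J] [Nonempty (Fin n)]
    (p : J → BitString n) : ∃ (W : Finset (Fin n)) (ρ : Fin n → Fin n),
      W.card ≤ 2 ^ Fintype.card J ∧ (∀ i, ρ i ∈ W) ∧ ∀ i j, p j (ρ i) = p j i := by
  -- The column of a wire lists its bit in every string; one wire is chosen per column value.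
  set col : Fin n → (J → Fin 2) := fun i j => p j i with hcol
  refine ⟨(Finset.univ.image col).image (Function.invFun col), fun i => Function.invFun col (col i),
    ?_, fun i => ?_, fun i j => ?_⟩
  · refine Finset.card_image_le.trans ((Finset.card_le_univ _).trans ?_)
    simp
  · exact Finset.mem_image_of_mem _ (Finset.mem_image_of_mem _ (Finset.mem_univ _))
  · exact congrFun (Function.invFun_eq (f := col) ⟨i, rfl⟩) j

/-- Finitely many strings can be moved into a coordinate subcube in linear cost. -/
theorem exists_gather (d : ℕ) : ∃ K n₀ : ℕ, ∀ n, n₀ ≤ n → ∀ p : BitString d → BitString n,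
    Function.Injective p → ∃ (g : Equiv.Perm (BitString n)) (e : Fin d → Fin n),
      Cost g (2 * n + K) ∧ Function.Injective e ∧
      ∀ j, g (p j) = Function.extend e j 1 := by
  obtain ⟨w, hw⟩ : ∃ w, w = 2 ^ Fintype.card (BitString d) := ⟨_, rfl⟩
  -- At most `2 ^ w` transpositions on at most `w` wires; `n ≥ 2 * w + 1` leaves enough dirty wires
  -- outside `W`.
  refine ⟨2 ^ w * (4 * w + (80 * w + 1)), 2 * w + 1, fun n hn p hp => ?_⟩
  have : Nonempty (Fin n) := ⟨⟨0, by omega⟩⟩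
  obtain ⟨W, ρ, hWw, hρW, hρ⟩ := exists_representatives p
  rw [← hw] at hWw
  -- On the given strings each wire outside `W` equals its representative, so adding the
  -- representative and then 1 yields the constant 1.
  obtain ⟨s, hs, hsx⟩ := exists_shear ρ 1 1 Wᶜ (fun i _ => by simp [hρW])
  have hsW : ∀ x i, i ∈ W → s x i = x i := fun x i hi => by
    rw [hsx, if_neg (by simpa using hi)]
  have hsp : ∀ j i, i ∉ W → s (p j) i = 1 := fun j i hi => by
    rw [hsx, if_pos (by simpa using hi), hρ]
    have : ∀ c : Fin 2, c + 1 * c + 1 = 1 := by decide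
    exact this _
  set q : BitString d → (W → Fin 2) := fun j i => p j i with hq
  have hqinj : Function.Injective q := by
    intro j j' hjj
    refine hp (funext fun i => ?_)
    have := congrFun hjj ⟨ρ i, hρW i⟩
    simpa only [hq, hρ] using this
  have hdW : Fintype.card (Fin d) ≤ Fintype.card W := by
    have h := Fintype.card_le_of_injective q hqinj
    simp only [Fintype.card_pi, Fintype.card_fin, Finset.prod_const, Finset.card_univ] at h
    rw [Fintype.card_fin]
    exact (Nat.pow_le_pow_iff_right (by norm_num)).1 h
  obtain ⟨ε⟩ := Function.Embedding.nonempty_of_card_le hdW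
  set q' : BitString d → (W → Fin 2) := fun j => Function.extend ε j 1 with hq'
  have hq'inj : Function.Injective q' := by
    intro j j' hjj
    funext a
    have := congrFun hjj (ε a)
    simpa only [hq', ε.injective.extend_apply] using this
  obtain ⟨σ, hσ⟩ := Equiv.Perm.exists_extending_pair q q' hqinj hq'inj
  have hT : ∀ t, Cost (mcx ((Finset.univ.image (Subtype.val : W → Fin n)).erase t) t)
      (80 * w + 1) := by
    intro t
    have hA : ((Finset.univ.image (Subtype.val : W → Fin n)).erase t) = W.erase t := by
      congr 1; ext i; simp
    rw [hA]
    have h1 : (W.erase t).card ≤ W.card := Finset.card_erase_le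
    have h2 : (insert t W)ᶜ.card = n - (insert t W).card := by
      rw [Finset.card_compl, Fintype.card_fin]
    have h3 := Finset.card_insert_le t W
    refine (cost_mcx_of_card_le (Z := (insert t W)ᶜ) (by omega) (Finset.notMem_erase t W)
      (by simp) ?_).mono (by omega)
    exact Disjoint.mono_left ((Finset.erase_subset _ _).trans (Finset.subset_insert t W))
      disjoint_compl_right
  obtain ⟨h, hh, hhc⟩ := exists_lift (e := (Subtype.val : W → Fin n)) Subtype.val_injective hT
    (2 ^ w) σ (by
      refine (Finset.card_le_univ _).trans ?_
      simp only [Fintype.card_pi, Fintype.card_fin, Finset.prod_const, Finset.card_univ,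
        Fintype.card_coe]
      exact Nat.pow_le_pow_right (by norm_num) hWw)
  refine ⟨h * s, fun a => (ε a : Fin n), (hhc.mul hs).mono ?_,
    Subtype.val_injective.comp ε.injective, fun j => funext fun i => ?_⟩
  · rw [Fintype.card_coe]
    have h1 : Wᶜ.card ≤ n := by simpa using Finset.card_le_univ Wᶜ
    have h2 : 2 ^ w * (4 * W.card + (80 * w + 1)) ≤ 2 ^ w * (4 * w + (80 * w + 1)) := by gcongr
    omega
  · have hEinj : Function.Injective fun a => (ε a : Fin n) :=
      Subtype.val_injective.comp ε.injective
    rw [Equiv.Perm.mul_apply]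
    by_cases hi : i ∈ W
    · have h1 : (fun k : W => s (p j) k) = q j := funext fun k => hsW _ _ k.2
      have h2 := (hh (s (p j))).1 ⟨i, hi⟩
      rw [h1, hσ] at h2
      rw [show h (s (p j)) i = Function.extend ε j 1 ⟨i, hi⟩ from h2]
      by_cases ha : ∃ a, ε a = ⟨i, hi⟩
      · obtain ⟨a, ha⟩ := ha
        have hai : (ε a : Fin n) = i := by rw [ha]
        rw [← ha, ← hai, ε.injective.extend_apply]
        exact (hEinj.extend_apply j 1 a).symm
      · rw [Function.extend_apply' _ _ _ ha, Function.extend_apply']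
        · rfl
        · rintro ⟨a, rfl⟩
          exact ha ⟨a, rfl⟩
    · rw [(hh (s (p j))).2 i (by rintro ⟨k, hk⟩ rfl; exact hi hk), hsp j i hi,
        Function.extend_apply']
      · rfl
      · rintro ⟨a, rfl⟩
        exact hi (ε a).2

/-- A permutation that swaps `2 ^ (d + 1)` prescribed pairs of strings, in linear cost. -/
theorem exists_swap_pairs (d : ℕ) : ∃ K n₀ : ℕ, ∀ n, n₀ ≤ n →
    ∀ p : BitString (d + 2) → BitString n, Function.Injective p →
      ∃ τ : Equiv.Perm (BitString n), Cost τ (164 * n + K) ∧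
        (∀ j, τ (p j) = p (mcx ∅ 0 j)) ∧ ∀ z, z ∉ Set.range p → τ z = z := by
  obtain ⟨K, n₀, h⟩ := exists_gather (d + 2)
  refine ⟨2 * K + 200, n₀, fun n hn p hp => ?_⟩
  obtain ⟨g, e, hg, he, hgp⟩ := h n hn p hp
  set A := (Finset.univ.image e)ᶜ with hA
  have hAe : ∀ a, e a ∉ A := fun a => by simp [hA]
  have hAmem : ∀ i, i ∈ A ↔ ¬ ∃ a, e a = i := fun i => by simp [hA]
  have h10 : e 1 ≠ e 0 := fun h => by
    have := he h
    simp at this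
  -- The wire `e 1` is neither control nor target, hence available as the dirty wire; this is why
  -- the subcube has dimension at least 2.
  have hmcx := cost_mcx_of_dirty (hAe 0) (hAe 1) h10
  have hgz : ∀ z, (g⁻¹ * mcx A (e 0) * g) z = g.symm (mcx A (e 0) (g z)) := fun z => rfl
  refine ⟨g⁻¹ * mcx A (e 0) * g, ((hg.inv.mul hmcx).mul hg).mono (by omega), fun j => ?_,
    fun z hz => ?_⟩
  · rw [hgz, Equiv.symm_apply_eq, hgp, hgp]
    have hones : ∀ i ∈ A, Function.extend e j (1 : BitString n) i = 1 := fun i hi => by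
      rw [Function.extend_apply' _ _ _ ((hAmem i).1 hi)]; rfl
    funext i
    by_cases hi : ∃ a, e a = i
    · obtain ⟨a, rfl⟩ := hi
      rw [he.extend_apply]
      by_cases ha : a = 0
      · subst ha
        rw [mcx_apply_target (hAe 0), if_pos hones, he.extend_apply, mcx_apply_target (by simp)]
        simp
      · rw [mcx_apply_of_ne _ (fun h => ha (he h)), he.extend_apply, mcx_apply_of_ne _ ha]
    · rw [mcx_apply_of_ne _ (fun h => hi ⟨0, h.symm⟩), Function.extend_apply' _ _ _ hi,
        Function.extend_apply' _ _ _ hi]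
  · rw [hgz, Equiv.symm_apply_eq]
    have hno : ¬ ∀ i ∈ A, g z i = 1 := by
      intro hones
      refine hz ⟨fun a => g z (e a), g.injective ?_⟩
      rw [hgp]
      funext i
      by_cases hi : ∃ a, e a = i
      · obtain ⟨a, rfl⟩ := hi
        rw [he.extend_apply]
      · rw [Function.extend_apply' _ _ _ hi, hones i ((hAmem i).2 hi)]; rfl
    funext i
    by_cases hi : i = e 0
    · subst hi
      rw [mcx_apply_target (hAe 0), if_neg hno]
    · rw [mcx_apply_of_ne _ hi]

/-! ### Reducing the support batch by batch -/

/-- Greedy choice: each selected point excludes only itself, its image and its preimage. -/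
theorem exists_subset_disjoint_image {α : Type*} [Fintype α] [DecidableEq α] (f : Equiv.Perm α)
    (k : ℕ) : 3 * k ≤ f.support.card → ∃ X ⊆ f.support, X.card = k ∧ ∀ x ∈ X, f x ∉ X := by
  induction k with
  | zero => exact fun _ => ⟨∅, by simp, by simp, by simp⟩
  | succ k ih =>
    intro hk
    obtain ⟨X, hX, hcard, hfX⟩ := ih (by omega)
    have h1 := Finset.card_union_le (X ∪ X.image f) (X.image f.symm)
    have h2 := Finset.card_union_le X (X.image f)
    have h3 : (X.image f).card ≤ X.card := Finset.card_image_le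
    have h4 : (X.image f.symm).card ≤ X.card := Finset.card_image_le
    obtain ⟨x, hx, hxX⟩ := Finset.exists_mem_notMem_of_card_lt_card
      (show (X ∪ X.image f ∪ X.image f.symm).card < f.support.card by omega)
    simp only [Finset.mem_union, Finset.mem_image, not_or, not_exists, not_and] at hxX
    obtain ⟨⟨hxX, hxf⟩, hxs⟩ := hxX
    refine ⟨insert x X, Finset.insert_subset hx hX, by
      rw [Finset.card_insert_of_notMem hxX, hcard], fun y hy hfy => ?_⟩
    rw [Finset.mem_insert] at hy hfy
    rcases hy with rfl | hy
    · rcases hfy with hfy | hfy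
      · exact Equiv.Perm.mem_support.1 hx hfy
      · exact hxs _ hfy (f.symm_apply_apply y)
    · rcases hfy with hfy | hfy
      · exact hxf y hy hfy
      · exact hfX y hy hfy

/-- Fix `2 ^ (d + 1)` further points in linear cost. -/
theorem exists_reduce_support (d : ℕ) : ∃ K n₀ : ℕ, ∀ n, n₀ ≤ n →
    ∀ f : Equiv.Perm (BitString n), 3 * 2 ^ (d + 1) ≤ f.support.card →
      ∃ τ : Equiv.Perm (BitString n), Cost τ (164 * n + K) ∧
        (τ * f).support.card + 2 ^ (d + 1) ≤ f.support.card := by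
  obtain ⟨K, n₀, h⟩ := exists_swap_pairs d
  refine ⟨K, n₀, fun n hn f hf => ?_⟩
  obtain ⟨X, hX, hcard, hfX⟩ := exists_subset_disjoint_image f _ hf
  have hXe : Fintype.card (BitString (d + 1)) = Fintype.card X := by simp [hcard]
  obtain ⟨E⟩ := Fintype.card_eq.mp hXe
  -- Bit 0 selects between `x` and `f x`, the other bits enumerate `X`; flipping bit 0 therefore
  -- swaps `x` with `f x`.
  set p : BitString (d + 2) → BitString n := fun j =>
    if j 0 = 0 then (E (Fin.tail j) : BitString n) else f (E (Fin.tail j)) with hp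
  have hpinj : Function.Injective p := by
    intro j j' hjj
    have h01 : ∀ a : Fin 2, a ≠ 0 → a = 1 := by decide
    have key : j 0 = j' 0 ∧ Fin.tail j = Fin.tail j' := by
      simp only [hp] at hjj
      by_cases h0 : j 0 = 0 <;> by_cases h0' : j' 0 = 0
      · rw [if_pos h0, if_pos h0'] at hjj
        exact ⟨h0.trans h0'.symm, E.injective (Subtype.ext hjj)⟩
      · rw [if_pos h0, if_neg h0'] at hjj
        exact absurd (hjj ▸ (E (Fin.tail j)).2) (hfX _ (E (Fin.tail j')).2)
      · rw [if_neg h0, if_pos h0'] at hjj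
        exact absurd (hjj ▸ (E (Fin.tail j')).2) (hfX _ (E (Fin.tail j)).2)
      · rw [if_neg h0, if_neg h0'] at hjj
        exact ⟨(h01 _ h0).trans (h01 _ h0').symm, E.injective (Subtype.ext (f.injective hjj))⟩
    rw [← Fin.cons_self_tail j, ← Fin.cons_self_tail j', key.1, key.2]
  obtain ⟨τ, hτ, hτp, hτz⟩ := h n hn p hpinj
  refine ⟨τ, hτ, ?_⟩
  have hfix : ∀ x ∈ X, τ (f x) = x := by
    intro x hx
    set j : BitString (d + 2) := Fin.cons 1 (E.symm ⟨x, hx⟩) with hj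
    have h1 : p j = f x := by simp [hp, hj]
    have h2 : p (mcx ∅ 0 j) = x := by
      have h3 : mcx ∅ 0 j 0 = 0 := by rw [mcx_apply_target (by simp)]; simp [hj]
      have h4 : Fin.tail (mcx ∅ 0 j) = E.symm ⟨x, hx⟩ := by
        funext i
        rw [Fin.tail, mcx_apply_of_ne _ (Fin.succ_ne_zero i), hj, Fin.cons_succ]
      simp [hp, h3, h4]
    rw [← h1, hτp, h2]
  -- `τ` moves only points `x` and `f x` with `x ∈ X`, all of them moved by `f`, so fixed points of
  -- `f` stay fixed.
  have hsub : (τ * f).support ⊆ f.support \ X := by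
    intro y hy
    rw [Equiv.Perm.mem_support, Equiv.Perm.mul_apply] at hy
    rw [Finset.mem_sdiff]
    refine ⟨?_, fun hyX => hy (hfix y hyX)⟩
    rw [Equiv.Perm.mem_support]
    intro hfy
    rw [hfy] at hy
    refine hy (hτz y ?_)
    rintro ⟨j, rfl⟩
    have hE := Equiv.Perm.mem_support.1 (hX (E (Fin.tail j)).2)
    simp only [hp] at hfy
    split_ifs at hfy
    · exact hE hfy
    · exact hE (f.injective hfy)
  have h1 := Finset.card_le_card hsub
  rw [Finset.card_sdiff_of_subset hX, hcard] at h1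
  omega

theorem exists_cost_blocks (d : ℕ) : ∃ K n₀ : ℕ, ∀ n, n₀ ≤ n →
    ∀ f : Equiv.Perm (BitString n), ∃ q : ℕ, 2 ^ (d + 1) * q ≤ f.support.card ∧
      Cost f (q * (164 * n + K) + 3 * 2 ^ (d + 1) * (4 * n + 733 * n ^ 2)) := by
  obtain ⟨K, n₀, h⟩ := exists_reduce_support d
  refine ⟨K, n₀, fun n hn f => ?_⟩
  induction hm : f.support.card using Nat.strong_induction_on generalizing f with
  | _ m ih =>
    subst hm
    rcases le_or_gt (3 * 2 ^ (d + 1)) f.support.card with hf | hf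
    · obtain ⟨τ, hτ, hcard⟩ := h n hn f hf
      have hpos : 0 < 2 ^ (d + 1) := by positivity
      obtain ⟨q, hq, hc⟩ := ih _ (by omega) (τ * f) rfl
      refine ⟨q + 1, by rw [mul_add, mul_one]; omega, ?_⟩
      have hf' : f = τ⁻¹ * (τ * f) := by rw [inv_mul_cancel_left]
      rw [hf']
      exact (hτ.inv.mul hc).mono (le_of_eq (by ring))
    · exact ⟨0, by simp, (cost_of_card_support_le f hf.le).mono (by omega)⟩

/-! ### Numerical estimates -/

theorem exists_square_le : ∃ c : ℝ, 0 ≤ c ∧ ∀ n : ℕ,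
    (n : ℝ) ^ 2 ≤ c * (2 : ℝ) ^ ((n : ℝ) / 2 - 1) := by
  have hl : 0 < Real.log 2 := Real.log_pos (by norm_num)
  refine ⟨2 * (2 * (2 / Real.log 2) ^ 2), by positivity, fun n => ?_⟩
  have h1 := Real.pow_div_factorial_le_exp (x := Real.log 2 * (n / 2)) (by positivity) 2
  rw [Real.rpow_sub (by norm_num), Real.rpow_def_of_pos (by norm_num), Real.rpow_one]
  have h2 : (n : ℝ) ^ 2 = 2 * (2 / Real.log 2) ^ 2 *
      ((Real.log 2 * (n / 2)) ^ 2 / (Nat.factorial 2 : ℕ)) := by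
    simp [Nat.factorial]
    field_simp
  calc (n : ℝ) ^ 2 = _ := h2
    _ ≤ 2 * (2 / Real.log 2) ^ 2 * Real.exp (Real.log 2 * (n / 2)) := by gcongr
    _ = _ := by ring

theorem exists_size_bound : ∃ K : ℝ, ∀ n : ℕ, 1 ≤ n → ∀ f : Equiv.Perm (BitString n),
    (f.support.card : ℝ) ≤ (2 : ℝ) ^ ((n : ℝ) / 2 - 1) → ∃ m : ℕ, Cost f m ∧
      (m : ℝ) ≤ (2 : ℝ) ^ ((n : ℝ) / 2 - 1) * (4 * n + K) := by
  -- Batches of `2 ^ 6 = 64` points: the smallest power of two for which `164 * n` per batch is at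
  -- most `4 * n` per point.
  obtain ⟨K, n₀, h⟩ := exists_cost_blocks 5
  obtain ⟨c, hc, hcn⟩ := exists_square_le
  -- The first bound covers `n < n₀`. The second absorbs the leftover of fewer than `192 = 3 * 64`
  -- points, with `737 = 4 + 733`.
  obtain ⟨M, hM₁, hM₂⟩ : ∃ M : ℝ, 4 * (n₀ : ℝ) + 733 * n₀ ^ 2 ≤ M ∧ K + 192 * 737 * c ≤ M :=
    ⟨_, le_max_left _ _, le_max_right _ _⟩
  refine ⟨M, fun n hn f hf => ?_⟩
  set S := (2 : ℝ) ^ ((n : ℝ) / 2 - 1) with hS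
  have hS0 : 0 < S := by positivity
  rcases le_or_gt n₀ n with hn₀ | hn₀
  · obtain ⟨q, hq, hcost⟩ := h n hn₀ f
    refine ⟨_, hcost, ?_⟩
    have hq' : (64 : ℝ) * q ≤ S := by
      refine le_trans ?_ hf
      exact_mod_cast (by simpa using hq : 64 * q ≤ f.support.card)
    have hn1 : (1 : ℝ) ≤ n := by exact_mod_cast hn
    have hK0 : (0 : ℝ) ≤ K := by positivity
    push_cast
    have e1 : (q : ℝ) * (164 * n + K) ≤ S * (4 * n + K) := by
      have : (q : ℝ) * (164 * n + K) ≤ (64 * q) * (4 * n + K) := by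
        have hq0 : (0 : ℝ) ≤ q := by positivity
        nlinarith [mul_nonneg hq0 hK0, mul_nonneg hq0 (by linarith : (0 : ℝ) ≤ n)]
      exact this.trans (mul_le_mul_of_nonneg_right hq' (by positivity))
    have e2 : (4 * n + 733 * (n : ℝ) ^ 2) ≤ 737 * (c * S) := by
      nlinarith [hcn n]
    have e3 : S * (4 * n + (K + 192 * 737 * c)) ≤ S * (4 * n + M) := by gcongr
    norm_num at e3 ⊢
    linarith
  · refine ⟨_, cost_of_card_support_le f le_rfl, ?_⟩
    push_cast
    have hnn : (n : ℝ) ≤ n₀ := by exact_mod_cast hn₀.le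
    calc (f.support.card : ℝ) * (4 * n + 733 * (n : ℝ) ^ 2)
        ≤ S * (4 * n₀ + 733 * (n₀ : ℝ) ^ 2) := by gcongr
      _ ≤ S * (4 * n + M) :=
        mul_le_mul_of_nonneg_left (hM₁.trans (le_add_of_nonneg_left (by positivity))) hS0.le

theorem four_mul_add_logb_lt {n : ℕ} (hn : 100 < n) :
    4 * (n : ℝ) + 64 * Real.logb 2 (n : ℝ) < 8.5 * (n : ℝ) := by
  have hn' : (101 : ℝ) ≤ n := by exact_mod_cast hn
  have hl := Real.log_two_gt_d9
  have hl0 : 0 < Real.log 2 := by linarith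
  have h128 : Real.log 128 = 7 * Real.log 2 := by
    rw [show (128 : ℝ) = 2 ^ 7 by norm_num, Real.log_pow]; norm_num
  -- Tangent line of `log` at 128, a power of two close enough to the threshold 101.
  have h1 := Real.log_le_sub_one_of_pos (show (0 : ℝ) < n / 128 by positivity)
  rw [Real.log_div (by positivity) (by norm_num), h128] at h1
  have h2 : Real.logb 2 n * Real.log 2 = Real.log n := by
    rw [Real.logb, div_mul_cancel₀ _ hl0.ne']
  have h3 : Real.logb 2 n * Real.log 2 < (4.5 / 64 * n) * Real.log 2 := by
    rw [h2]
    nlinarith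
  have h4 := lt_of_mul_lt_mul_right h3 hl0.le
  linarith

end ReversibleCircuit

theorem theorem3 :
    (∃ K : ℝ, ∀ n : ℕ, 1 ≤ n → ∀ f : Equiv.Perm (ReversibleCircuit.BitString n),
      (f.support.card : ℝ) ≤ (2 : ℝ) ^ ((n : ℝ) / 2 - 1) →
      ∃ C : ReversibleCircuit.Circuit n, ReversibleCircuit.Implements C f ∧
        (C.length : ℝ) ≤
          (2 : ℝ) ^ ((n : ℝ) / 2 - 1) * (4 * (n : ℝ) + 64 * Real.logb 2 (n : ℝ) + K)) ∧
    (∀ n : ℕ, 100 < n →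
      4 * (n : ℝ) + 64 * Real.logb 2 (n : ℝ) < 8.5 * (n : ℝ)) := by
  refine ⟨?_, fun n hn => ReversibleCircuit.four_mul_add_logb_lt hn⟩
  obtain ⟨K, h⟩ := ReversibleCircuit.exists_size_bound
  refine ⟨K, fun n hn f hf => ?_⟩
  obtain ⟨m, ⟨⟨C, hC, hz⟩, -⟩, hm⟩ := h n hn f hf
  refine ⟨C, hz, ?_⟩
  have hlog : 0 ≤ Real.logb 2 (n : ℝ) :=
    Real.logb_nonneg (by norm_num) (by exact_mod_cast hn)
  have hCm : (C.length : ℝ) ≤ m := by exact_mod_cast hC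
  refine (hCm.trans hm).trans (mul_le_mul_of_nonneg_left ?_ (by positivity))
  linarith
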